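/- Let $K$ be a non-empty perfect compact Hausdorff space (that is, without isolated points), let $C(K)$ be the real Banach space of continuous functions $K\to\mathbb{R}$ with the supremum norm, and identify $C(K)^*$ with the space $M(K)$ of finite signed regular Borel measures on $K$, via $\mu(f)=\int_K f\,d\mu$. A bounded linear operator $T$ on $C(K)$ is called a weak multiplier if there are a function $g:K\to\mathbb{R}$ that is integrable with respect to every measure in $M(K)$ and a weakly compact bounded linear operator $S$ on $C(K)^*$ such that $T^*=g\,\mathrm{Id}+S$, i.e. $T^*\mu=g\mu+S\mu$ for every $\mu\in M(K)$, where $(g\mu)(A)=\int_A g\,d\mu$ for Borel sets $A$. Suppose that every bounded linear operator on $C(K)$ is a weak multiplier. Then $C(K)$ is extremely non-complex: for every bounded linear operator $T$ on $C(K)$, $$\|\mathrm{Id}+T^2\|=1+\|T^2\|.$$ -/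

import Mathlib

open MeasureTheory

noncomputable section

namespace ExtremelyNonComplex

/-- A real normed space `X` is extremely non-complex if `‖Id + T²‖ = 1 + ‖T²‖` for every bounded
linear operator `T` on `X`. -/
def IsExtremelyNonComplex (X : Type*) [NormedAddCommGroup X] [NormedSpace ℝ X] : Prop :=
  ∀ T : X →L[ℝ] X, ‖ContinuousLinearMap.id ℝ X + T ∘L T‖ = 1 + ‖T ∘L T‖

/-- A bounded operator is weakly compact if it maps the closed unit ball to a relatively weakly
compact set. -/
def IsWeaklyCompactOperator {X Y : Type*} [NormedAddCommGroup X] [NormedSpace ℝ X]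
    [NormedAddCommGroup Y] [NormedSpace ℝ Y] (S : X →L[ℝ] Y) : Prop :=
  IsCompact (closure (toWeakSpace ℝ Y '' (S '' Metric.closedBall (0 : X) 1)))

/-- The Banach space adjoint `T* : X* → X*`, `T* φ = φ ∘ T`. -/
def adjointOperator {X : Type*} [NormedAddCommGroup X] [NormedSpace ℝ X] (T : X →L[ℝ] X) :
    StrongDual ℝ X →L[ℝ] StrongDual ℝ X :=
  ContinuousLinearMap.precomp ℝ T

variable {K : Type*} [TopologicalSpace K] [CompactSpace K] [MeasurableSpace K]

/-- A (finite, countably additive) signed Borel measure on `K` is a Radon measure, that is, an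
element of `M(K)`, if its total variation is regular. -/
def IsRadon (μ : SignedMeasure K) : Prop := μ.variation.Regular

lemma isFiniteMeasure_variation {X : Type*} [MeasurableSpace X] (μ : SignedMeasure X) :
    IsFiniteMeasure μ.variation := by
  rw [← SignedMeasure.totalVariation_eq_variation]
  infer_instance

lemma integrable_continuousMap [BorelSpace K] (μ : SignedMeasure K) (f : C(K, ℝ)) : μ.Integrable f := by
  have := isFiniteMeasure_variation μ
  exact Integrable.of_bound f.continuous.measurable.aestronglyMeasurable ‖f‖
    (Filter.Eventually.of_forall f.norm_coe_le_norm)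

lemma norm_integral_continuousMap_le (μ : SignedMeasure K) (f : C(K, ℝ)) :
    ‖∫ᵛ x, f x ∂•μ‖ ≤ μ.variation.real Set.univ * ‖f‖ := by
  have := isFiniteMeasure_variation μ
  refine (VectorMeasure.norm_integral_le_of_norm_le_const (C := ‖f‖)
    (Filter.Eventually.of_forall f.norm_coe_le_norm)).trans ?_
  have h := ContinuousLinearMap.opNorm_lsmul_le (𝕜 := ℝ) (R := ℝ) (E := ℝ)
  calc ‖f‖ * ‖ContinuousLinearMap.lsmul (E := ℝ) ℝ ℝ‖ * μ.variation.real Set.univ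
      ≤ ‖f‖ * 1 * μ.variation.real Set.univ := by gcongr
    _ = μ.variation.real Set.univ * ‖f‖ := by ring

/-- The functional `f ↦ ∫ f dμ` on `C(K)` given by a signed measure `μ`. -/
def measureFunctional [BorelSpace K] (μ : SignedMeasure K) : StrongDual ℝ C(K, ℝ) :=
  LinearMap.mkContinuous
    { toFun := fun f => ∫ᵛ x, f x ∂•μ
      map_add' := fun f g => VectorMeasure.integral_fun_add
        (integrable_continuousMap μ f) (integrable_continuousMap μ g)
      map_smul' := fun c f => VectorMeasure.integral_fun_smul μ _ c f }
    (μ.variation.real Set.univ) (norm_integral_continuousMap_le μ)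

/-- The measure `g μ`, that is, `A ↦ ∫_A g dμ`, for a `|μ|`-integrable function `g`. -/
def densityMul (g : K → ℝ) (μ : SignedMeasure K) : SignedMeasure K :=
  μ.withDensity g (ContinuousLinearMap.lsmul ℝ ℝ)

/-- `T` is a weak multiplier if `T* = g Id + S` on `C(K)* = M(K)`, where `g` is integrable with
respect to all Radon measures on `K` and `S` is a weakly compact operator on `C(K)*`. By the Riesz
representation theorem the functionals `measureFunctional μ`, `μ` Radon, are all of `C(K)*`. -/
def IsWeakMultiplier [BorelSpace K] (T : C(K, ℝ) →L[ℝ] C(K, ℝ)) : Prop :=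
  ∃ (g : K → ℝ) (S : StrongDual ℝ C(K, ℝ) →L[ℝ] StrongDual ℝ C(K, ℝ)),
    (∀ μ : SignedMeasure K, IsRadon μ → μ.Integrable g) ∧
    IsWeaklyCompactOperator (X := StrongDual ℝ C(K, ℝ)) (Y := StrongDual ℝ C(K, ℝ)) S ∧
    ∀ μ : SignedMeasure K, IsRadon μ →
      adjointOperator T (measureFunctional μ) =
        measureFunctional (densityMul g μ) + S (measureFunctional μ)

end ExtremelyNonComplex

end

noncomputable section

namespace ExtremelyNonComplex

open Filter Topology

/-! ### Weakly compact sets of functionals: a gliding hump argument -/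

section WeakCompactness

variable {X : Type*} [NormedAddCommGroup X] [NormedSpace ℝ X]

/-! Evaluating `T*` at Dirac measures gives `T f (x) = g(x) f(x) + ψ_x(f)` with `g` bounded and all
`ψ_x` in one weakly compact set, so `T² f (x) = g(x)² f(x) + R_x(f)` with `R_x = g(x) ψ_x + T* ψ_x`.
The coefficient is a square, hence nonnegative.

Weak compactness forces the atom of `R_x` at `x` to be small for all but finitely many `x`;
otherwise disjoint bumps would contradict `false_of_le_apply_of_isCompact`. Since `K` is perfect,
such an `x` exists near any point where `T² f` almost attains `‖T²‖`. Raising `f` to the value 1 at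
`x` by a narrow bump barely changes `R_x(f)` and does not decrease the square term, which gives the
Daugavet equation (`norm_id_add_of_small_atoms`). -/

lemma continuous_weakSpace_apply (Λ : StrongDual ℝ X) :
    Continuous fun x : WeakSpace ℝ X => Λ ((toWeakSpace ℝ X).symm x) :=
  WeakBilin.eval_continuous (topDualPairing ℝ X).flip Λ

lemma exists_tail_sum_le {a : ℕ → ℝ} (ha : Summable fun n => |a n|) {δ : ℝ} (hδ : 0 < δ) :
    ∃ N, ∀ n, N ≤ n → ∀ F : Finset ℕ, (∀ i ∈ F, n ≤ i) → ∑ i ∈ F, |a i| ≤ δ := by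
  obtain ⟨s, hs⟩ := summable_iff_vanishing_norm.1 ha δ hδ
  refine ⟨s.sup id + 1, fun n hn F hF => ?_⟩
  refine ((le_abs_self _).trans_lt (hs F (Finset.disjoint_left.2 fun i hi his => ?_))).le
  have := hF i hi
  have := Finset.le_sup (f := id) his
  simp only [id] at this
  omega

lemma abs_tsum_le_of_sum_abs_le {a : ℕ → ℝ} {c : ℝ} (ha : ∀ F : Finset ℕ, ∑ n ∈ F, |a n| ≤ c) :
    |∑' n, a n| ≤ c := by
  have hs : Summable fun n => ‖a n‖ := summable_of_sum_le (fun _ => norm_nonneg _) ha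
  rw [← Real.norm_eq_abs]
  exact (norm_tsum_le_tsum_norm hs).trans (hs.tsum_le_of_sum_le ha)

lemma sum_half_pow_le {δ : ℝ} (hδ : 0 < δ) (F : Finset ℕ) : ∑ i ∈ F, δ / 2 / 2 ^ i ≤ δ :=
  ((summable_geometric_two' δ).sum_le_tsum F fun i _ => by positivity).trans
    (tsum_geometric_two' δ).le

/-- The series of the `v n` need not converge in `X`; its sum is taken in the bidual. -/
lemma exists_sumFunctional (v : ℕ → X)
    (hv : ∀ (ψ : StrongDual ℝ X) (F : Finset ℕ), ∑ n ∈ F, |ψ (v n)| ≤ ‖ψ‖) :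
    ∃ Λ : StrongDual ℝ (StrongDual ℝ X), ∀ ψ, Λ ψ = ∑' n, ψ (v n) := by
  have hs (ψ : StrongDual ℝ X) : Summable fun n => |ψ (v n)| :=
    summable_of_sum_le (fun _ => abs_nonneg _) (hv ψ)
  have hle (ψ : StrongDual ℝ X) : ‖∑' n, ψ (v n)‖ ≤ 1 * ‖ψ‖ := by
    rw [one_mul, Real.norm_eq_abs]
    exact abs_tsum_le_of_sum_abs_le (hv ψ)
  let L : StrongDual ℝ X →ₗ[ℝ] ℝ :=
    { toFun := fun ψ => ∑' n, ψ (v n)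
      map_add' := fun ψ χ => (hs ψ).of_abs.tsum_add (hs χ).of_abs
      map_smul' := fun c ψ => by
        simp only [smul_apply, smul_eq_mul, RingHom.id_apply, tsum_mul_left] }
  exact ⟨L.mkContinuous 1 hle, fun _ => rfl⟩

/-- A relatively weakly compact sequence of functionals cannot stay bounded away from zero along a
weakly unconditionally summable sequence of vectors. -/
lemma false_of_le_apply_of_isCompact (v : ℕ → X)
    (hv : ∀ (ψ : StrongDual ℝ X) (F : Finset ℕ), ∑ n ∈ F, |ψ (v n)| ≤ ‖ψ‖)
    {C : Set (WeakSpace ℝ (StrongDual ℝ X))} (hC : IsCompact C) (φ : ℕ → StrongDual ℝ X)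
    (hφ : ∀ n, toWeakSpace ℝ (StrongDual ℝ X) (φ n) ∈ C) {ε : ℝ} (hε : 0 < ε)
    (h : ∀ n, ε ≤ φ n (v n)) : False := by
  have hs (ψ : StrongDual ℝ X) : Summable fun n => |ψ (v n)| :=
    summable_of_sum_le (fun _ => abs_nonneg _) (hv ψ)
  have hcont (x : X) : Continuous fun ψ : WeakSpace ℝ (StrongDual ℝ X) =>
      (toWeakSpace ℝ (StrongDual ℝ X)).symm ψ x :=
    continuous_weakSpace_apply (ContinuousLinearMap.apply ℝ ℝ x)
  -- Along a subsequence, the off-diagonal terms cost at most `3δ`, so `Λ ≥ 5δ` on it, while `Λ ≤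
  -- 2δ` at its cluster points.
  obtain ⟨δ, hδ, hδε⟩ : ∃ δ > 0, ε = 8 * δ := ⟨ε / 8, by positivity, by ring⟩
  obtain ⟨b', hb'⟩ : ∃ b', MapClusterPt b' atTop fun n => toWeakSpace ℝ (StrongDual ℝ X) (φ n) := by
    obtain ⟨b', -, hb'⟩ := hC.exists_mapClusterPt (f := atTop)
      (u := fun n => toWeakSpace ℝ (StrongDual ℝ X) (φ n)) (by simpa using ⟨0, fun n _ => hφ n⟩)
    exact ⟨b', hb'⟩
  set b : StrongDual ℝ X := (toWeakSpace ℝ (StrongDual ℝ X)).symm b' with hb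
  have hfreq (s : Finset ℕ) :
      ∃ᶠ n in atTop, ∀ m ∈ s, |φ n (v m)| ≤ |b (v m)| + δ / 2 / 2 ^ m := by
    have : ∀ᶠ ψ in 𝓝 b', ∀ m ∈ s,
        |(toWeakSpace ℝ (StrongDual ℝ X)).symm ψ (v m)| < |b (v m)| + δ / 2 / 2 ^ m := by
      refine (eventually_all_finset s).2 fun m _ => ?_
      refine (hcont (v m)).abs.continuousAt.eventually_lt_const ?_
      have : 0 < δ / 2 / 2 ^ m := by positivity
      simpa [← hb] using this
    refine (hb'.frequently this).mono fun n hn m hm => ?_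
    simpa using (hn m hm).le
  -- Gliding hump: earlier bumps are controlled by closeness to `b`, later ones by summability.
  obtain ⟨f, hfP, hfr⟩ := exists_seq_of_forall_finset_exists
    (fun n => ∀ F : Finset ℕ, (∀ i ∈ F, n ≤ i) → ∑ i ∈ F, |b (v i)| ≤ δ)
    (fun m n => m < n ∧ |φ n (v m)| ≤ |b (v m)| + δ / 2 / 2 ^ m ∧
      ∀ F : Finset ℕ, (∀ i ∈ F, n ≤ i) → ∑ i ∈ F, |φ m (v i)| ≤ δ) fun s _ => by
    obtain ⟨N, hN⟩ := exists_tail_sum_le (hs b) hδ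
    have h2 : ∀ᶠ n in atTop, ∀ m ∈ s, m < n ∧
        ∀ F : Finset ℕ, (∀ i ∈ F, n ≤ i) → ∑ i ∈ F, |φ m (v i)| ≤ δ := by
      refine (eventually_all_finset s).2 fun m _ => ?_
      obtain ⟨M, hM⟩ := exists_tail_sum_le (hs (φ m)) hδ
      filter_upwards [eventually_gt_atTop m, eventually_ge_atTop M] with n h1 h2
      exact ⟨h1, hM n h2⟩
    obtain ⟨n, hn, hn2, hn3⟩ :=
      ((hfreq s).and_eventually (h2.and (eventually_ge_atTop N))).exists
    exact ⟨n, hN n hn3, fun m hm => ⟨(hn2 m hm).1, hn m hm, (hn2 m hm).2⟩⟩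
  have hmono : StrictMono f := fun m n hmn => (hfr m n hmn).1
  have hsumle (G : Finset ℕ) : ∑ j ∈ G, (|b (v (f j))| + δ / 2 / 2 ^ f j) ≤ 2 * δ := by
    have h1 := hfP 0 (G.map ⟨f, hmono.injective⟩) fun i hi => by
      obtain ⟨j, -, rfl⟩ := Finset.mem_map.1 hi
      exact hmono.monotone (Nat.zero_le j)
    have h2 := sum_half_pow_le hδ (G.map ⟨f, hmono.injective⟩)
    rw [Finset.sum_map] at h1 h2
    rw [Finset.sum_add_distrib]
    simp only [Function.Embedding.coeFn_mk] at h1 h2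
    linarith
  have hvf (ψ : StrongDual ℝ X) (F : Finset ℕ) : ∑ n ∈ F, |ψ (v (f n))| ≤ ‖ψ‖ := by
    have := hv ψ (F.map ⟨f, hmono.injective⟩)
    rwa [Finset.sum_map] at this
  obtain ⟨Λ, hΛ⟩ := exists_sumFunctional (fun n => v (f n)) hvf
  have hsf (ψ : StrongDual ℝ X) : Summable fun n => |ψ (v (f n))| :=
    summable_of_sum_le (fun _ => abs_nonneg _) (hvf ψ)
  have hlow (k : ℕ) : 5 * δ ≤ Λ (φ (f k)) := by
    have h0 := h (f k)
    have h1 (F : Finset ℕ) (hF : k ∉ F) : ∑ j ∈ F, |φ (f k) (v (f j))| ≤ 3 * δ := by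
      rw [← Finset.sum_filter_add_sum_filter_not F (fun j => j < k)]
      have h2 : ∑ j ∈ F with j < k, |φ (f k) (v (f j))| ≤ 2 * δ :=
        (Finset.sum_le_sum fun j hj => (hfr j k (Finset.mem_filter.1 hj).2).2.1).trans (hsumle _)
      have h3 := (hfr k (k + 1) k.lt_succ_self).2.2
        ((F.filter fun j => ¬ j < k).map ⟨f, hmono.injective⟩) fun i hi => by
          obtain ⟨j, hj, rfl⟩ := Finset.mem_map.1 hi
          obtain ⟨hj, hjk⟩ := Finset.mem_filter.1 hj
          have : j ≠ k := fun h => hF (h ▸ hj)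
          exact hmono.monotone (by omega)
      rw [Finset.sum_map] at h3
      simp only [Function.Embedding.coeFn_mk] at h3
      linarith
    rw [hΛ, (hsf (φ (f k))).of_abs.tsum_eq_add_tsum_ite k]
    have h4 : |∑' n, if n = k then 0 else φ (f k) (v (f n))| ≤ 3 * δ := by
      refine abs_tsum_le_of_sum_abs_le fun F => ?_
      rw [← Finset.sum_filter_add_sum_filter_not F (fun j => j = k)]
      refine le_trans (le_of_eq ?_) (h1 (F.filter fun j => ¬ j = k) (by simp))
      rw [Finset.sum_eq_zero, zero_add]
      · exact Finset.sum_congr rfl fun j hj => by rw [if_neg (Finset.mem_filter.1 hj).2]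
      · intro j hj
        rw [if_pos (Finset.mem_filter.1 hj).2, abs_zero]
    linarith [(abs_le.1 h4).1]
  obtain ⟨c, hc⟩ :
      ∃ c, MapClusterPt c atTop fun n => toWeakSpace ℝ (StrongDual ℝ X) (φ (f n)) := by
    obtain ⟨c, -, hc⟩ := hC.exists_mapClusterPt (f := atTop)
      (u := fun n => toWeakSpace ℝ (StrongDual ℝ X) (φ (f n)))
      (by simpa using ⟨0, fun n _ => hφ (f n)⟩)
    exact ⟨c, hc⟩
  -- The cluster point `c` need not be `b`, but it inherits the bounds imposed on all later
  -- functionals.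
  have hc1 (j : ℕ) :
      |(toWeakSpace ℝ (StrongDual ℝ X)).symm c (v (f j))| ≤ |b (v (f j))| + δ / 2 / 2 ^ f j := by
    by_contra! hlt
    have hev := (hcont (v (f j))).abs.continuousAt.eventually_const_lt hlt
    obtain ⟨k, hk, hjk⟩ :=
      ((hc.frequently hev).and_eventually (eventually_gt_atTop j)).exists
    have := (hfr j k hjk).2.1
    simp only [LinearEquiv.symm_apply_apply] at hk
    linarith
  have hc2 : Λ ((toWeakSpace ℝ (StrongDual ℝ X)).symm c)
      ≤ 2 * δ := by
    rw [hΛ]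
    refine (le_abs_self _).trans (abs_tsum_le_of_sum_abs_le fun F => ?_)
    exact (Finset.sum_le_sum fun j _ => hc1 j).trans (hsumle F)
  have hev := (continuous_weakSpace_apply Λ).continuousAt.eventually_lt_const
      (hc2.trans_lt (by linarith : 2 * δ < 5 * δ))
  obtain ⟨k, hk⟩ := (hc.frequently hev).exists
  exact (hlow k).not_gt (by simpa using hk)

lemma IsWeaklyCompactOperator.exists_isCompact {Y : Type*} [NormedAddCommGroup Y] [NormedSpace ℝ Y]
    {S : X →L[ℝ] Y} (hS : IsWeaklyCompactOperator S) :
    ∃ (C : Set (WeakSpace ℝ Y)) (M : ℝ), IsCompact C ∧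
      ∀ x, ‖x‖ ≤ 1 → toWeakSpace ℝ Y (S x) ∈ C ∧ ‖S x‖ ≤ M :=
  ⟨_, ‖S‖, hS, fun x hx => ⟨subset_closure
    (Set.mem_image_of_mem _ (Set.mem_image_of_mem _ (mem_closedBall_zero_iff.2 hx))),
    S.unit_le_opNorm x hx⟩⟩

end WeakCompactness

/-! ### Disjoint bumps, small atoms and the Daugavet equation -/

section Bumps

variable {K : Type*} [TopologicalSpace K] [CompactSpace K]

/-- Test `ψ` on the signed sum of the bumps, whose norm is at most 1 by disjointness. -/
lemma sum_abs_apply_le_of_pairwise_disjoint {U : ℕ → Set K}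
    (hU : Pairwise (Function.onFun Disjoint U))
    {v : ℕ → C(K, ℝ)} (hvU : ∀ n, ∀ y ∉ U n, v n y = 0) (hv : ∀ n, ‖v n‖ ≤ 1)
    (ψ : StrongDual ℝ C(K, ℝ)) (F : Finset ℕ) : ∑ n ∈ F, |ψ (v n)| ≤ ‖ψ‖ := by
  set w : C(K, ℝ) := ∑ n ∈ F, (SignType.sign (ψ (v n)) : ℝ) • v n with hw
  have hs (r : ℝ) : |(SignType.sign r : ℝ)| ≤ 1 := by
    rcases lt_trichotomy r 0 with h | h | h <;> simp [h]
  have hw1 : ‖w‖ ≤ 1 := by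
    refine (ContinuousMap.norm_le _ zero_le_one).2 fun y => ?_
    simp only [hw, ContinuousMap.sum_apply, ContinuousMap.smul_apply, smul_eq_mul]
    by_cases hy : ∃ m ∈ F, y ∈ U m
    · obtain ⟨m, hm, hym⟩ := hy
      rw [Finset.sum_eq_single m]
      · rw [norm_mul]
        exact mul_le_one₀ (hs _) (norm_nonneg _) (((v m).norm_coe_le_norm y).trans (hv m))
      · intro n _ hnm
        rw [hvU n y fun h => Set.disjoint_left.1 (hU hnm) h hym, mul_zero]
      · exact fun h => (h hm).elim
    · push Not at hy
      rw [Finset.sum_eq_zero fun n hn => by rw [hvU n y (hy n hn), mul_zero]]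
      simp
  calc ∑ n ∈ F, |ψ (v n)| = ψ w := by
        simp only [hw, map_sum, map_smul, smul_eq_mul, sign_mul_self]
    _ ≤ ‖ψ‖ * ‖w‖ := (le_abs_self _).trans (ψ.le_opNorm w)
    _ ≤ ‖ψ‖ * 1 := by gcongr
    _ = ‖ψ‖ := mul_one _

variable [T2Space K]

/-- By compactness `B` accumulates at some `p`. Each chosen set stays away from a neighbourhood of
`p`, which leaves points of `B` for the next choice. -/
lemma exists_seq_mem_isOpen_pairwise_disjoint {B : Set K} (hB : B.Infinite) :
    ∃ (x : ℕ → K) (U : ℕ → Set K), (∀ n, x n ∈ B) ∧ (∀ n, IsOpen (U n)) ∧ (∀ n, x n ∈ U n) ∧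
      Pairwise (Function.onFun Disjoint U) := by
  obtain ⟨p, hp⟩ := Set.Infinite.exists_accPt_principal hB
  have : Std.Symm (α := Set K) Disjoint := ⟨fun _ _ h => h.symm⟩
  obtain ⟨U, hU, hd⟩ := exists_seq_of_forall_finset_exists'
    (fun U : Set K => (∃ x ∈ B, x ∈ U) ∧ IsOpen U ∧ Uᶜ ∈ 𝓝 p) Disjoint fun S hS => by
    have hmem : ⋂ U ∈ S, interior Uᶜ ∈ 𝓝 p :=
      (biInter_finset_mem _).2 fun U hU => interior_mem_nhds.2 (hS _ hU).2.2
    obtain ⟨y, ⟨hyU, hyB⟩, hyp⟩ := accPt_iff_nhds.1 hp _ hmem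
    obtain ⟨V, W, hV, hW, hyV, hpW, hVW⟩ := t2_separation hyp
    refine ⟨V ∩ ⋂ U ∈ S, interior Uᶜ, ⟨⟨y, hyB, hyV, hyU⟩, ?_, ?_⟩, fun U hU => ?_⟩
    · exact hV.inter (isOpen_biInter_finset fun _ _ => isOpen_interior)
    · refine mem_of_superset (hW.mem_nhds hpW) fun z hzW ⟨hzV, _⟩ => ?_
      exact Set.disjoint_left.1 hVW hzV hzW
    · exact Set.disjoint_left.2 fun z hzU ⟨_, hzU'⟩ =>
        interior_subset (Set.mem_iInter₂.1 hzU' U hU) hzU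
  choose x hxB hxU using fun n => (hU n).1
  exact ⟨x, U, hxB, fun n => (hU n).2.1, hxU, hd⟩

/-- A relatively weakly compact family of functionals indexed by `K` has, at all but finitely many
points `x`, an atom of size at most `ε` at `x`. -/
lemma finite_setOf_forall_exists_lt_apply {C : Set (WeakSpace ℝ (StrongDual ℝ C(K, ℝ)))}
    (hC : IsCompact C) (φ : K → StrongDual ℝ C(K, ℝ))
    (hφ : ∀ x, toWeakSpace ℝ (StrongDual ℝ C(K, ℝ)) (φ x) ∈ C) {ε : ℝ} (hε : 0 < ε) :
    {x | ∀ U, IsOpen U → x ∈ U → ∃ v : C(K, ℝ), (∀ y ∉ U, v y = 0) ∧ ‖v‖ ≤ 1 ∧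
      ε < φ x v}.Finite := by
  by_contra hB
  obtain ⟨x, U, hxB, hUo, hxU, hd⟩ := exists_seq_mem_isOpen_pairwise_disjoint hB
  choose v hvU hv hlt using fun n => hxB n (U n) (hUo n) (hxU n)
  exact false_of_le_apply_of_isCompact v (sum_abs_apply_le_of_pairwise_disjoint hd hvU hv) hC
    (fun n => φ (x n)) (fun n => hφ (x n)) hε fun n => (hlt n).le

/-- If `A f (x) = c(x) f(x) + R_x(f)` with `c ≥ 0` and the functionals `R_x` have arbitrarily small
atoms at `x` for all but finitely many `x`, then `A` satisfies the Daugavet equation. -/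
lemma norm_id_add_of_small_atoms [PerfectSpace K] [Nonempty K] (A : C(K, ℝ) →L[ℝ] C(K, ℝ))
    (c : K → ℝ) (hc : ∀ x, 0 ≤ c x) (R : K → StrongDual ℝ C(K, ℝ))
    (hA : ∀ f x, A f x = c x * f x + R x f)
    (hR : ∀ ε > 0, {x | ∀ U, IsOpen U → x ∈ U → ∃ v : C(K, ℝ), (∀ y ∉ U, v y = 0) ∧ ‖v‖ ≤ 1 ∧
      ε < R x v}.Finite) :
    ‖ContinuousLinearMap.id ℝ C(K, ℝ) + A‖ = 1 + ‖A‖ := by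
  refine le_antisymm ((ContinuousLinearMap.opNorm_add_le _ _).trans
    (add_le_add_left ContinuousLinearMap.norm_id_le _)) ?_
  refine le_of_forall_pos_le_add fun η hη => ?_
  obtain ⟨f, hf1, hfA⟩ := A.exists_lt_apply_of_lt_opNorm (sub_lt_self ‖A‖ (half_pos hη))
  obtain ⟨x₀, hx₀⟩ : ∃ x, ‖A‖ - η / 2 < |A f x| := by
    by_contra! hle
    exact hfA.not_ge ((ContinuousMap.norm_le_of_nonempty (A f)).2 hle)
  obtain ⟨f, hf1, hx₀⟩ : ∃ f : C(K, ℝ), ‖f‖ < 1 ∧ ‖A‖ - η / 2 < A f x₀ := by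
    rcases lt_abs.1 hx₀ with h | h
    · exact ⟨f, hf1, h⟩
    · exact ⟨-f, by rwa [norm_neg], by simpa using h⟩
  have hopen : {x | ‖A‖ - η / 2 < A f x} ∈ 𝓝 x₀ :=
    (A f).continuous.continuousAt.eventually_const_lt hx₀
  obtain ⟨x, hx, hxR⟩ := (infinite_of_mem_nhds x₀ hopen).exists_notMem_finite
    (hR (η / 4) (by positivity))
  simp only [Set.mem_ofPred_eq, not_forall, not_exists, not_and, not_lt] at hx hxR
  obtain ⟨U, hUo, hxU, hRU⟩ := hxR
  obtain ⟨u, hu0, hu1, hu⟩ := exists_continuous_zero_one_of_isClosed hUo.isClosed_compl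
    (isClosed_singleton (x := x)) (Set.disjoint_singleton_right.2 fun h => h hxU)
  have hfy (y : K) : |f y| ≤ 1 := (f.norm_coe_le_norm y).trans hf1.le
  -- `f + w = (1 - u) f + u` is a pointwise convex combination of `f` and 1, equal to 1 at `x`.
  set w : C(K, ℝ) := (1 - f) * u with hw
  have hux : u x = 1 := hu1 rfl
  have hRw : -(η / 2) ≤ R x w := by
    -- `w` can have norm up to 2; halving makes it admissible, and the sign yields a lower bound.
    have := hRU (-(1 / 2 : ℝ) • w) (fun y hy => by simp [hw, hu0 hy]) (by
      refine (ContinuousMap.norm_le _ zero_le_one).2 fun y => ?_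
      have h1 := abs_le.1 (hfy y)
      obtain ⟨h2, h3⟩ := hu y
      simp only [hw, ContinuousMap.smul_apply, ContinuousMap.mul_apply, ContinuousMap.sub_apply,
        ContinuousMap.one_apply, smul_eq_mul, Real.norm_eq_abs, abs_le]
      constructor <;> nlinarith)
    rw [map_smul, smul_eq_mul] at this
    linarith
  have hnorm : ‖f + w‖ ≤ 1 := by
    refine (ContinuousMap.norm_le _ zero_le_one).2 fun y => ?_
    have h1 := abs_le.1 (hfy y)
    obtain ⟨h2, h3⟩ := hu y
    simp only [hw, ContinuousMap.add_apply, ContinuousMap.mul_apply, ContinuousMap.sub_apply,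
        ContinuousMap.one_apply, Real.norm_eq_abs, abs_le]
    constructor <;> nlinarith
  have hval : (f + w) x = 1 := by simp [hw, hux]
  have h0 (B : C(K, ℝ) →L[ℝ] C(K, ℝ)) : B (f + w) x ≤ ‖B‖ :=
    (le_abs_self _).trans (((B (f + w)).norm_coe_le_norm x).trans (B.unit_le_opNorm _ hnorm))
  have h1 := h0 (ContinuousLinearMap.id ℝ C(K, ℝ) + A)
  have h2 : (ContinuousLinearMap.id ℝ C(K, ℝ) + A) (f + w) x = 1 + (c x + (R x f + R x w)) := by
    have h3 := hA (f + w) x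
    rw [hval, mul_one, map_add (R x)] at h3
    rw [add_apply, ContinuousMap.add_apply, h3]
    simp only [ContinuousLinearMap.id_apply, hval]
  have h3 := hA f x
  -- The sign of `c` enters only here.
  have h4 : c x * f x ≤ c x := mul_le_of_le_one_right (hc x) (abs_le.1 (hfy x)).2
  linarith

end Bumps

/-! ### Dirac measures as elements of the dual -/

section Dirac

variable {K : Type*} [MeasurableSpace K]

lemma densityMul_dirac [MeasurableSingletonClass K] {g : K → ℝ} {x : K}
    (hg : (VectorMeasure.dirac x (1 : ℝ) : SignedMeasure K).Integrable g) :
    densityMul g (VectorMeasure.dirac x 1) = VectorMeasure.dirac x (g x) := by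
  classical
  ext s hs
  rw [densityMul, VectorMeasure.withDensity_apply hg, VectorMeasure.setIntegral_dirac hs]
  split_ifs with h
  · simp [VectorMeasure.dirac_apply_of_mem hs h]
  · simp [VectorMeasure.dirac_apply_of_notMem h]

variable [TopologicalSpace K] [BorelSpace K]

lemma isRadon_dirac [T2Space K] (x : K) : IsRadon (VectorMeasure.dirac x (1 : ℝ)) := by
  rw [IsRadon, VectorMeasure.variation_dirac, enorm_one, one_smul]
  refine { lt_top_of_isCompact := fun _ _ => measure_lt_top _ _, outerRegular := fun A hA r hr => ?_,
           innerRegular := fun U hU r hr => ?_ }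
  · by_cases hx : x ∈ A
    · exact ⟨Set.univ, Set.subset_univ A, isOpen_univ, by simpa [hA, hx] using hr⟩
    · refine ⟨{x}ᶜ, Set.subset_compl_singleton_iff.2 hx, isOpen_compl_singleton, ?_⟩
      rw [Measure.dirac_apply' _ (measurableSet_singleton x).compl]
      simpa using zero_le.trans_lt hr
  · have hx : x ∈ U := by
      by_contra hx
      rw [Measure.dirac_apply' _ hU.measurableSet, Set.indicator_of_notMem hx] at hr
      exact not_lt_zero hr
    refine ⟨{x}, Set.singleton_subset_iff.2 hx, isCompact_singleton, ?_⟩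
    rw [Measure.dirac_apply' _ hU.measurableSet, Set.indicator_of_mem hx] at hr
    simpa using hr

lemma measureFunctional_dirac_apply [CompactSpace K] [T2Space K] (x : K) (r : ℝ) (f : C(K, ℝ)) :
    measureFunctional (VectorMeasure.dirac x r) f = r * f x := by
  change ∫ᵛ y, f y ∂•(VectorMeasure.dirac x r) = _
  rw [VectorMeasure.integral_dirac, ContinuousLinearMap.lsmul_apply, smul_eq_mul, mul_comm]

end Dirac

/-! ### Weak multipliers and their squares -/

section WeakMultipliers

variable {K : Type*} [TopologicalSpace K] [CompactSpace K] [T2Space K] [MeasurableSpace K]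
  [BorelSpace K]

/-- A weak multiplier `T` acts as `T f (x) = g(x) f(x) + ψ_x(f)`, where the functionals `ψ_x` form
a relatively weakly compact set. -/
lemma IsWeakMultiplier.exists_apply_eq {T : C(K, ℝ) →L[ℝ] C(K, ℝ)} (hT : IsWeakMultiplier T) :
    ∃ (g : K → ℝ) (ψ : K → StrongDual ℝ C(K, ℝ)) (C : Set (WeakSpace ℝ (StrongDual ℝ C(K, ℝ))))
      (M : ℝ), (∀ f x, T f x = g x * f x + ψ x f) ∧ (∀ x, |g x| ≤ M) ∧ IsCompact C ∧
      ∀ x, toWeakSpace ℝ (StrongDual ℝ C(K, ℝ)) (ψ x) ∈ C := by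
  obtain ⟨g, S, hg, hS, hTS⟩ := hT
  set δ : K → StrongDual ℝ C(K, ℝ) := fun x => measureFunctional (VectorMeasure.dirac x 1) with hδ
  have hδ1 (x : K) : ‖δ x‖ ≤ 1 := by
    refine ContinuousLinearMap.opNorm_le_bound _ zero_le_one fun f => ?_
    rw [hδ, measureFunctional_dirac_apply, one_mul, one_mul]
    exact f.norm_coe_le_norm x
  have hTf (f : C(K, ℝ)) (x : K) : T f x = g x * f x + S (δ x) f := by
    have h := congr($(hTS _ (isRadon_dirac x)) f)
    rw [densityMul_dirac (hg _ (isRadon_dirac x)), add_apply,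
      measureFunctional_dirac_apply] at h
    rw [← h, ← one_mul (T f x), ← measureFunctional_dirac_apply]
    rfl
  obtain ⟨C, M, hC, hCM⟩ := hS.exists_isCompact
  refine ⟨g, fun x => S (δ x), C, ‖T‖ + M, hTf, fun x => ?_, hC, fun x => (hCM _ (hδ1 x)).1⟩
  have h1 : ‖(1 : C(K, ℝ))‖ ≤ 1 := (ContinuousMap.norm_le _ zero_le_one).2 fun y => by simp
  -- Testing on the constant 1 bounds `g` uniformly.
  have h2 : g x = T 1 x - S (δ x) 1 := by simp [hTf 1 x]
  rw [h2]
  refine (abs_sub _ _).trans (add_le_add ?_ ?_)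
  · exact ((T 1).norm_coe_le_norm x).trans (T.unit_le_opNorm _ h1)
  · exact ((S (δ x)).unit_le_opNorm _ h1).trans (hCM _ (hδ1 x)).2

/-- The square of a weak multiplier satisfies the Daugavet equation. -/
lemma IsWeakMultiplier.norm_id_add_comp_self [PerfectSpace K] [Nonempty K]
    {T : C(K, ℝ) →L[ℝ] C(K, ℝ)} (hT : IsWeakMultiplier T) :
    ‖ContinuousLinearMap.id ℝ C(K, ℝ) + T ∘L T‖ = 1 + ‖T ∘L T‖ := by
  obtain ⟨g, ψ, C, M, hTf, hg, hC, hψ⟩ := hT.exists_apply_eq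
  refine norm_id_add_of_small_atoms (T ∘L T) (fun x => g x ^ 2) (fun x => sq_nonneg _)
    (fun x => g x • ψ x + adjointOperator T (ψ x)) (fun f x => ?_) fun ε hε => ?_
  · rw [ContinuousLinearMap.comp_apply, hTf (T f) x, hTf f x]
    change _ = g x ^ 2 * f x + (g x * ψ x f + ψ x (T f))
    ring
  set N := |M| + 1 with hN
  have hN0 : 0 < N := by positivity
  have hgN (x : K) : |g x| ≤ N := (hg x).trans ((le_abs_self M).trans (by linarith))
  -- An atom of `R_x` above `ε` needs one of `ψ_x` above `ε / (2N)` or one of `T* ψ_x` above `ε /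
  -- 2`; the `T* ψ_x` lie in the weakly compact image of `C`.
  refine ((finite_setOf_forall_exists_lt_apply hC ψ hψ (ε := ε / (2 * N)) (by positivity)).union
    (finite_setOf_forall_exists_lt_apply
      (hC.image (WeakSpace.map (adjointOperator T)).continuous)
      (fun x => adjointOperator T (ψ x)) (fun x => Set.mem_image_of_mem _ (hψ x))
      (half_pos hε))).subset fun x hx => ?_
  by_contra hx'
  simp only [Set.mem_union, Set.mem_ofPred_eq, not_or, not_forall, not_exists, not_and,
    not_lt] at hx'
  obtain ⟨⟨U, hU, hxU, hU1⟩, ⟨V, hV, hxV, hV1⟩⟩ := hx'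
  obtain ⟨v, hv, hv1, hlt⟩ := hx (U ∩ V) (hU.inter hV) ⟨hxU, hxV⟩
  have h1 := hV1 v (fun y hy => hv y fun h => hy h.2) hv1
  have h2 := hU1 v (fun y hy => hv y fun h => hy h.1) hv1
  have h3 := hU1 (-v) (fun y hy => by simp [hv y fun h => hy h.1]) (by rwa [norm_neg])
  rw [map_neg] at h3
  have h4 : g x * ψ x v ≤ ε / 2 := by
    calc g x * ψ x v ≤ |g x| * |ψ x v| := (le_abs_self _).trans (abs_mul _ _).le
      _ ≤ N * (ε / (2 * N)) := by
        gcongr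
        · exact hgN x
        · exact abs_le.2 ⟨by linarith, h2⟩
      _ = ε / 2 := by field_simp
  have h5 : (g x • ψ x + adjointOperator T (ψ x)) v = g x * ψ x v + adjointOperator T (ψ x) v := rfl
  linarith

end WeakMultipliers

end ExtremelyNonComplex

end

theorem mainTheorem1 (K : Type*) [TopologicalSpace K] [CompactSpace K] [T2Space K]
    [PerfectSpace K] [Nonempty K] [MeasurableSpace K] [BorelSpace K]
    (hK : ∀ T : C(K, ℝ) →L[ℝ] C(K, ℝ), ExtremelyNonComplex.IsWeakMultiplier T) :
    ExtremelyNonComplex.IsExtremelyNonComplex C(K, ℝ) :=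
  fun T => (hK T).norm_id_add_comp_self
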